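/- Let $\mu$ be a probability measure on a measurable space $\mathcal X$ and let $k:\mathcal X\times\mathcal X\to\mathbb R$ be a measurable symmetric positive semi-definite kernel with $\int_{\mathcal X}k(x,x)\,\mathrm d\mu(x)<\infty$ whose reproducing kernel Hilbert space $\mathcal H_k$ is separable. Let $\sigma_1\ge\sigma_2\ge\cdots\ge0$ be the eigenvalues, counted with multiplicity (and followed by zeros if only finitely many of them are positive), of the integral operator \[ \mathcal K:L^2(\mu)\to L^2(\mu),\qquad (\mathcal Kf)(x)=\int_{\mathcal X}k(x,y)f(y)\,\mathrm d\mu(y). \] Let $Z=(z_i)_{i=1}^\ell$ be an i.i.d. sample of $\ell$ points from $\mu$, let $k(Z,Z)=(k(z_i,z_j))_{i,j=1}^\ell$ be its Gram matrix, and let $\lambda_1\ge\cdots\ge\lambda_\ell$ be the eigenvalues of $k(Z,Z)$, counted with multiplicity. Then for every integer $s\ge0$ the series $\sum_{i>s}\sigma_i$ converges, $\frac1\ell\sum_{i=s+1}^\ell\lambda_i$ is integrable, and \[ \mathbb E\left[\frac1\ell\sum_{i=s+1}^\ell\lambda_i\right]\le\sum_{i>s}\sigma_i . \] -/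

import Mathlib

open MeasureTheory ProbabilityTheory

/-- `k` is a symmetric positive semi-definite kernel on `X` (every Gram matrix on finitely many
points is positive semi-definite), it is measurable, and its diagonal is integrable:
`∫ k(x,x) dμ(x) < ∞`. -/
structure IsIntegrableKernel {X : Type*} [MeasurableSpace X] (k : X → X → ℝ) (μ : Measure X) :
    Prop where
  posSemidef : (Matrix.of k).PosSemidef
  measurable : Measurable (Function.uncurry k)
  integrable_diag : Integrable (fun x => k x x) μ

namespace IsIntegrableKernel

variable {X : Type*} [MeasurableSpace X] {k : X → X → ℝ} {μ : Measure X}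

theorem symm (hk : IsIntegrableKernel k μ) (x y : X) : k x y = k y x := by
  simpa using hk.posSemidef.isHermitian.apply y x

theorem diag_nonneg (hk : IsIntegrableKernel k μ) (x : X) : 0 ≤ k x x := by
  simpa using hk.posSemidef.diag_nonneg (i := x)

theorem sq_le (hk : IsIntegrableKernel k μ) (x y : X) : k x y ^ 2 ≤ k x x * k y y := by
  have h := (hk.posSemidef.submatrix (![x, y] : Fin 2 → X)).det_nonneg
  rw [Matrix.det_fin_two] at h
  simp [hk.symm y x] at h
  nlinarith

theorem abs_le (hk : IsIntegrableKernel k μ) (x y : X) :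
    |k x y| ≤ Real.sqrt (k x x) * Real.sqrt (k y y) := by
  rw [← Real.sqrt_mul (hk.diag_nonneg x)]
  exact Real.abs_le_sqrt (hk.sq_le x y)

theorem measurable_diag (hk : IsIntegrableKernel k μ) : Measurable fun x => k x x :=
  hk.measurable.comp (measurable_id.prodMk measurable_id)

theorem memLp_sqrt_diag (hk : IsIntegrableKernel k μ) :
    MemLp (fun x => Real.sqrt (k x x)) 2 μ := by
  refine (memLp_two_iff_integrable_sq hk.measurable_diag.sqrt.aestronglyMeasurable).2 ?_
  simpa only [Real.sq_sqrt (hk.diag_nonneg _)] using hk.integrable_diag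

theorem integrable_mul (hk : IsIntegrableKernel k μ) (f : Lp ℝ 2 μ) (x : X) :
    Integrable (fun y => k x y * f y) μ := by
  have h : MemLp (fun y => k x y) 2 μ := by
    refine (hk.memLp_sqrt_diag.const_mul (Real.sqrt (k x x))).mono
      (hk.measurable.comp measurable_prodMk_left).aestronglyMeasurable (ae_of_all _ fun y => ?_)
    simpa [abs_mul, abs_of_nonneg, Real.sqrt_nonneg] using hk.abs_le x y
  exact h.integrable_mul (Lp.memLp f)

theorem memLp_integral [SFinite μ] (hk : IsIntegrableKernel k μ) (f : Lp ℝ 2 μ) :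
    MemLp (fun x => ∫ y, k x y * f y ∂μ) 2 μ := by
  have hd : Integrable (fun y => Real.sqrt (k y y) * |f y|) μ :=
    hk.memLp_sqrt_diag.integrable_mul (Lp.memLp f).abs
  refine (hk.memLp_sqrt_diag.const_mul (∫ y, Real.sqrt (k y y) * |f y| ∂μ)).mono ?_
    (ae_of_all _ fun x => ?_)
  · refine StronglyMeasurable.aestronglyMeasurable
      (StronglyMeasurable.integral_prod_right (f := fun x y => k x y * f y) ?_)
    exact (hk.measurable.mul ((Lp.stronglyMeasurable f).measurable.comp
      measurable_snd)).stronglyMeasurable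
  · have h0 : 0 ≤ ∫ y, Real.sqrt (k y y) * |f y| ∂μ :=
      integral_nonneg fun y => mul_nonneg (Real.sqrt_nonneg _) (abs_nonneg _)
    rw [Real.norm_of_nonneg (mul_nonneg h0 (Real.sqrt_nonneg _)), mul_comm,
      ← integral_const_mul]
    refine norm_integral_le_of_norm_le (hd.const_mul _) (ae_of_all _ fun y => ?_)
    rw [Real.norm_eq_abs, abs_mul, ← mul_assoc]
    exact mul_le_mul_of_nonneg_right (hk.abs_le x y) (abs_nonneg _)

/-- The integral operator `𝒦 : L²(μ) → L²(μ)`, `(𝒦 f)(x) = ∫ k(x,y) f(y) dμ(y)`. -/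
noncomputable def integralOperator [SFinite μ] (hk : IsIntegrableKernel k μ) :
    Lp ℝ 2 μ →ₗ[ℝ] Lp ℝ 2 μ where
  toFun f := (hk.memLp_integral f).toLp _
  map_add' f g := by
    rw [← MemLp.toLp_add]
    refine MemLp.toLp_congr _ _ (ae_of_all _ fun x => ?_)
    rw [Pi.add_apply, ← integral_add (hk.integrable_mul f x) (hk.integrable_mul g x)]
    refine integral_congr_ae ?_
    filter_upwards [Lp.coeFn_add f g] with y hy
    rw [hy, Pi.add_apply, mul_add]
  map_smul' c f := by
    rw [RingHom.id_apply, ← MemLp.toLp_const_smul]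
    refine MemLp.toLp_congr _ _ (ae_of_all _ fun x => ?_)
    rw [Pi.smul_apply, ← integral_smul]
    refine integral_congr_ae ?_
    filter_upwards [Lp.coeFn_smul c f] with y hy
    rw [hy, Pi.smul_apply, smul_eq_mul, smul_eq_mul]
    ring

end IsIntegrableKernel

/-- The eigenvalues of a compact positive self-adjoint operator `T` in decreasing order, repeated
according to multiplicity and followed by zeros if only finitely many of them are positive.
Indices start at `0`: `eigenvalueSeq T n` is the `(n+1)`-st largest eigenvalue, that is the largest
`c > 0` such that the eigenvalues `≥ c` have total multiplicity at least `n + 1`, and it is `0` if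
there is no such `c` (the supremum of the empty set of reals is `0`). -/
noncomputable def eigenvalueSeq {E : Type*} [AddCommGroup E] [Module ℝ E] (T : Module.End ℝ E)
    (n : ℕ) : ℝ :=
  sSup {c : ℝ | 0 < c ∧
    ((n + 1 : ℕ) : Cardinal) ≤
      Module.rank ℝ (⨆ c' : ℝ, ⨆ _ : c ≤ c', Module.End.eigenspace T c' : Submodule ℝ E)}

/-- The Gram matrix `k(Z, Z) = (k(zᵢ, zⱼ))ᵢⱼ` of the points `Z = (z₁, …, z_ℓ)`. -/
def gramMatrix {X : Type*} (k : X → X → ℝ) {ℓ : ℕ} (Z : Fin ℓ → X) : Matrix (Fin ℓ) (Fin ℓ) ℝ :=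
  Matrix.of fun i j => k (Z i) (Z j)

theorem IsIntegrableKernel.isHermitian_gramMatrix {X : Type*} [MeasurableSpace X] {k : X → X → ℝ}
    {μ : Measure X} (hk : IsIntegrableKernel k μ) {ℓ : ℕ} (Z : Fin ℓ → X) :
    (gramMatrix k Z).IsHermitian :=
  (hk.posSemidef.submatrix Z).isHermitian

/-- For a real symmetric matrix `A` of size `ℓ` with eigenvalues `λ₁ ≥ ⋯ ≥ λ_ℓ`, the sum
`∑_{i=s+1}^ℓ λᵢ` of all but the `s` largest eigenvalues. (`eigenvalues₀` is the decreasing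
enumeration of the eigenvalues, with indices from `0`.) -/
noncomputable def eigenvalueTail {ℓ : ℕ} {A : Matrix (Fin ℓ) (Fin ℓ) ℝ} (hA : A.IsHermitian)
    (s : ℕ) : ℝ :=
  ∑ i with s ≤ (i : Fin (Fintype.card (Fin ℓ))).val, hA.eigenvalues₀ i

/-!
Let `φ` be a feature map with `k x y = ⟪φ x, φ y⟫`. The integral operator is the analysis operator
`h ↦ ⟪φ ·, h⟫` after the synthesis operator `f ↦ ∫ f φ dμ`; composed in the other order they give
the second-moment operator of `φ`, which therefore has the same positive eigenvalues. The span `V`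
of its `s` leading eigenvectors has mean reconstruction error
`∫ ‖φ x - P_V (φ x)‖² dμ(x) = ∑_{i > s} σᵢ` (principal component analysis in feature space). On the
other hand, by Ky Fan's minimum principle and the Eckart–Young argument, the tail
`∑_{i > s} λᵢ` of the Gram matrix is at most the total squared error of approximating the `φ (zⱼ)`
by vectors of any subspace of dimension at most `s`. Choosing this subspace to be `V` for every
sample and taking expectations gives the claim.
-/

section DecreasingRearrangement

open Set

variable {ι : Type*} {τ : ι → ℝ}

/-- The decreasing enumeration of the positive values of a real family with finite superlevel sets,
each value repeated as often as it is taken and the enumeration being followed by zeros if there are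
only finitely many of them. Indices start at `0`. It is defined through the counting function
`c ↦ #{i | c ≤ τ i}` because `eigenvalueSeq` is defined through the eigenvalue counting function. -/
noncomputable def decreasingRearrangement (τ : ι → ℝ) (n : ℕ) : ℝ :=
  sSup {c : ℝ | 0 < c ∧ n < {i | c ≤ τ i}.ncard}

theorem exists_linearOrder_antitone (τ : ι → ℝ) : ∃ _ : LinearOrder ι, Antitone τ := by
  classical
  let : LinearOrder ι := linearOrderOfSTO WellOrderingRel
  -- sort by decreasing value, breaking ties by an arbitrary linear order
  let key : ι → ℝᵒᵈ ×ₗ ι := fun i => toLex (OrderDual.toDual (τ i), i)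
  have key_injective : key.Injective := fun i j h => congrArg (fun x => (ofLex x).2) h
  refine ⟨LinearOrder.lift' key key_injective, fun i j hij => ?_⟩
  rcases Prod.Lex.le_iff.1 (show key i ≤ key j from hij) with h | h
  · exact (OrderDual.toDual_lt_toDual.1 h).le
  · exact (OrderDual.toDual_inj.1 h.1).ge

section Antitone

variable [LinearOrder ι]

theorem finite_Iio_of_antitone (hτ : Antitone τ) (hfin : ∀ c > 0, {i | c ≤ τ i}.Finite)
    {i : ι} (hi : 0 < τ i) : (Iio i).Finite :=
  (hfin _ hi).subset fun _ hj => hτ (le_of_lt hj)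

theorem ncard_Iio_lt_ncard_superlevel_iff (hτ : Antitone τ) {c : ℝ} {i : ι}
    (hi : (Iio i).Finite) (hc : {j | c ≤ τ j}.Finite) :
    (Iio i).ncard < {j | c ≤ τ j}.ncard ↔ c ≤ τ i := by
  refine ⟨fun hlt => ?_, fun hci => ?_⟩
  · by_contra! hic
    have hsub : {j | c ≤ τ j} ⊆ Iio i := fun j hj =>
      lt_of_not_ge fun hij => (hic.trans_le hj).not_ge (hτ hij)
    exact hlt.not_ge (ncard_le_ncard hsub hi)
  · exact ncard_lt_ncard ⟨fun j hj => hci.trans (hτ (le_of_lt hj)),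
      fun h => lt_irrefl i (h hci)⟩ hc

theorem decreasingRearrangement_ncard_Iio (hτ : Antitone τ)
    (hfin : ∀ c > 0, {i | c ≤ τ i}.Finite) {i : ι} (hi : 0 < τ i) :
    decreasingRearrangement τ (Iio i).ncard = τ i := by
  have hset : {c : ℝ | 0 < c ∧ (Iio i).ncard < {j | c ≤ τ j}.ncard} = Ioc 0 (τ i) :=
    Set.ext fun c => and_congr_right fun hc =>
      ncard_Iio_lt_ncard_superlevel_iff hτ (finite_Iio_of_antitone hτ hfin hi) (hfin c hc)
  rw [decreasingRearrangement, hset, csSup_Ioc hi]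

theorem ncard_Iio_injective (hτ : Antitone τ) (hfin : ∀ c > 0, {i | c ≤ τ i}.Finite)
    (hpos : ∀ i, 0 < τ i) : Function.Injective fun i : ι => (Iio i).ncard :=
  StrictMono.injective fun i j hij =>
    ncard_lt_ncard ⟨Iio_subset_Iio hij.le, fun h => lt_irrefl i (h hij)⟩
      (finite_Iio_of_antitone hτ hfin (hpos j))

theorem decreasingRearrangement_eq_zero (hτ : Antitone τ)
    (hfin : ∀ c > 0, {i | c ≤ τ i}.Finite) (hpos : ∀ i, 0 < τ i) {n : ℕ}
    (hn : n ∉ range fun i : ι => (Iio i).ncard) : decreasingRearrangement τ n = 0 := by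
  suffices h : {c : ℝ | 0 < c ∧ n < {i | c ≤ τ i}.ncard} = ∅ by
    rw [decreasingRearrangement, h, Real.sSup_empty]
  refine eq_empty_of_forall_notMem fun c hcn => hn ?_
  obtain ⟨hc, hnc⟩ := hcn
  have hS := hfin c hc
  -- the positions of the indices in the superlevel set are the numbers below its cardinality
  have hsurj : SurjOn (fun i : ι => (Iio i).ncard) hS.toFinset
      (Finset.range {i | c ≤ τ i}.ncard) := by
    refine Finset.surjOn_of_injOn_of_card_le _ (fun i hi => ?_)
      (ncard_Iio_injective hτ hfin hpos).injOn ?_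
    · rw [Finset.mem_coe, Finite.mem_toFinset] at hi
      simpa using (ncard_Iio_lt_ncard_superlevel_iff hτ
        (finite_Iio_of_antitone hτ hfin (hpos i)) hS).2 hi
    · rw [Finset.card_range, ncard_eq_toFinset_card _ hS]
  obtain ⟨i, -, hi⟩ := hsurj (Finset.mem_coe.2 (Finset.mem_range.2 hnc))
  exact ⟨i, hi⟩

end Antitone

theorem exists_injective_decreasingRearrangement_comp (hpos : ∀ i, 0 < τ i)
    (hfin : ∀ c > 0, {i | c ≤ τ i}.Finite) :
    ∃ r : ι → ℕ, r.Injective ∧ decreasingRearrangement τ ∘ r = τ ∧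
      ∀ n ∉ range r, decreasingRearrangement τ n = 0 := by
  obtain ⟨_, hτ⟩ := exists_linearOrder_antitone τ
  exact ⟨fun i => (Iio i).ncard, ncard_Iio_injective hτ hfin hpos,
    funext fun i => decreasingRearrangement_ncard_Iio hτ hfin (hpos i),
    fun _ => decreasingRearrangement_eq_zero hτ hfin hpos⟩

theorem decreasingRearrangement_subtype_pos (τ : ι → ℝ) :
    decreasingRearrangement (fun i : {i // 0 < τ i} => τ i) = decreasingRearrangement τ := by
  refine funext fun n => congrArg sSup (Set.ext fun c => and_congr_right fun hc => ?_)
  have himage : Subtype.val '' {i : {i // 0 < τ i} | c ≤ τ i} = {i | c ≤ τ i} := by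
    ext i
    simpa using fun hi : c ≤ τ i => hc.trans_le hi
  rw [← himage, ncard_image_of_injective _ Subtype.val_injective]

theorem exists_hasSum_decreasingRearrangement_of_pos (hpos : ∀ i, 0 < τ i) (hsum : Summable τ)
    (s : ℕ) :
    ∃ J : Finset ι, J.card ≤ s ∧
      HasSum (fun n => decreasingRearrangement τ (s + n)) (∑' i, τ i - ∑ i ∈ J, τ i) := by
  have hfin : ∀ c > 0, {i | c ≤ τ i}.Finite := fun c hc => by
    simpa [Filter.eventually_cofinite] using hsum.tendsto_cofinite_zero.eventually_lt_const hc
  obtain ⟨r, hr, hcomp, hzero⟩ := exists_injective_decreasingRearrangement_comp hpos hfin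
  have htotal : HasSum (decreasingRearrangement τ) (∑' i, τ i) :=
    (hr.hasSum_iff hzero).1 (by rw [hcomp]; exact hsum.hasSum)
  refine ⟨(Finset.range s).preimage r hr.injOn, ?_, ?_⟩
  · refine (Finset.card_le_card_of_injOn r (fun i hi => ?_) hr.injOn).trans
      (Finset.card_range s).le
    simpa using hi
  · have hhead : ∑ n ∈ Finset.range s, decreasingRearrangement τ n =
        ∑ i ∈ (Finset.range s).preimage r hr.injOn, τ i := by
      rw [← Finset.sum_preimage r _ hr.injOn _ fun n _ hn => hzero n hn]
      exact Finset.sum_congr rfl fun i _ => congrFun hcomp i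
    simpa only [hhead, add_comm s] using (hasSum_nat_add_iff' s).2 htotal

theorem exists_hasSum_decreasingRearrangement (hnonneg : ∀ i, 0 ≤ τ i) (hsum : Summable τ)
    (s : ℕ) :
    ∃ J : Finset ι, J.card ≤ s ∧
      HasSum (fun n => decreasingRearrangement τ (s + n)) (∑' i, τ i - ∑ i ∈ J, τ i) := by
  obtain ⟨J, hJ, hJsum⟩ := exists_hasSum_decreasingRearrangement_of_pos
    (τ := fun i : {i // 0 < τ i} => τ i) (fun i => i.2) (hsum.subtype _) s
  refine ⟨J.map (Function.Embedding.subtype _), by rwa [Finset.card_map], ?_⟩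
  have htsum : ∑' i : {i // 0 < τ i}, τ i = ∑' i, τ i :=
    tsum_subtype_eq_of_support_subset fun i hi => (hnonneg i).lt_of_ne' hi
  simpa only [decreasingRearrangement_subtype_pos, htsum, Finset.sum_map,
    Function.Embedding.subtype_apply] using hJsum

end DecreasingRearrangement

section EigenvalueSeq

open Module.End Set

universe u v

/-- The sum of the eigenspaces of `T` for the eigenvalues `≥ c`; its rank is the eigenvalue counting
function that defines `eigenvalueSeq`. -/
def superlevelEigenspace {E : Type*} [AddCommGroup E] [Module ℝ E] (T : Module.End ℝ E) (c : ℝ) :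
    Submodule ℝ E :=
  ⨆ c' : ℝ, ⨆ _ : c ≤ c', eigenspace T c'

theorem eigenvalueSeq_eq_sSup {E : Type*} [AddCommGroup E] [Module ℝ E] (T : Module.End ℝ E)
    (n : ℕ) : eigenvalueSeq T n =
      sSup {c : ℝ | 0 < c ∧ ((n + 1 : ℕ) : Cardinal) ≤ Module.rank ℝ (superlevelEigenspace T c)} :=
  rfl

theorem lift_rank_superlevelEigenspace_comp_le {E : Type u} {F : Type v} [AddCommGroup E]
    [Module ℝ E] [AddCommGroup F] [Module ℝ F] (A : E →ₗ[ℝ] F) (B : F →ₗ[ℝ] E) {c : ℝ}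
    (hc : 0 < c) :
    Cardinal.lift.{v} (Module.rank ℝ (superlevelEigenspace (B ∘ₗ A) c)) ≤
      Cardinal.lift.{u} (Module.rank ℝ (superlevelEigenspace (A ∘ₗ B) c)) := by
  have hmaps : superlevelEigenspace (B ∘ₗ A) c ≤ (superlevelEigenspace (A ∘ₗ B) c).comap A := by
    refine iSup₂_le fun c' hc' v hv => ?_
    have hAv : A v ∈ eigenspace (A ∘ₗ B) c' := by
      rw [mem_eigenspace_iff] at hv ⊢
      simpa only [LinearMap.comp_apply, map_smul] using congrArg A hv
    exact Submodule.mem_iSup_of_mem c' (Submodule.mem_iSup_of_mem hc' hAv)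
  have hker : A.ker ≤ eigenspace (B ∘ₗ A) 0 := fun v hv => by
    simp [LinearMap.mem_ker.1 hv]
  have hdisj : Disjoint (eigenspace (B ∘ₗ A) 0) (superlevelEigenspace (B ∘ₗ A) c) :=
    (eigenspaces_iSupIndep (B ∘ₗ A)).disjoint_biSup (y := {c' | c ≤ c'}) hc.not_ge
  exact LinearMap.lift_rank_le_of_injective (A.restrict hmaps)
    ((LinearMap.injective_restrict_iff _).2 (hdisj.mono_left hker).symm)

theorem eigenvalueSeq_comp_comm {E : Type u} {F : Type v} [AddCommGroup E] [Module ℝ E]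
    [AddCommGroup F] [Module ℝ F] (A : E →ₗ[ℝ] F) (B : F →ₗ[ℝ] E) :
    eigenvalueSeq (A ∘ₗ B) = eigenvalueSeq (B ∘ₗ A) := by
  funext n
  rw [eigenvalueSeq_eq_sSup, eigenvalueSeq_eq_sSup]
  refine congrArg sSup (Set.ext fun c => and_congr_right fun hc => ?_)
  exact ⟨fun h => Cardinal.nat_le_lift_iff.1 ((Cardinal.nat_le_lift_iff.2 h).trans
      (lift_rank_superlevelEigenspace_comp_le B A hc)),
    fun h => Cardinal.nat_le_lift_iff.1 ((Cardinal.nat_le_lift_iff.2 h).trans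
      (lift_rank_superlevelEigenspace_comp_le A B hc))⟩

variable {H : Type u} [NormedAddCommGroup H] [InnerProductSpace ℝ H]

theorem exists_hilbertBasis_eigenvectors [CompleteSpace H] {T : H →L[ℝ] H}
    (hc : IsCompactOperator T) (hT : T.IsSymmetric) :
    ∃ (ι : Type u) (b : HilbertBasis ι ℝ H) (τ : ι → ℝ), ∀ i, T (b i) = τ i • b i := by
  choose w e _ using fun c : ℝ => exists_hilbertBasis ℝ (eigenspace T.toLinearMap c)
  let v : (Σ c, w c) → H := fun i => e i.1 i.2
  have hv : Orthonormal ℝ v :=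
    hT.orthogonalFamily_eigenspaces.orthonormal_sigma_orthonormal fun c => (e c).orthonormal
  have horth : (Submodule.span ℝ (range v))ᗮ = ⊥ := by
    rw [eq_bot_iff, ← T.orthogonalComplement_iSup_eigenspaces_eq_bot hc hT,
      ← Submodule.iInf_orthogonal]
    refine fun x hx => (Submodule.mem_iInf _).2 fun c u hu => ?_
    have hzero : innerSL ℝ x ∘L (eigenspace T.toLinearMap c).subtypeL = 0 :=
      ContinuousLinearMap.ext_on (Submodule.dense_iff_topologicalClosure_eq_top.2 (e c).dense_span)
        (by
          rintro _ ⟨i, rfl⟩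
          exact Submodule.inner_left_of_mem_orthogonal
            (Submodule.subset_span (mem_range_self (⟨c, i⟩ : Σ c, w c))) hx)
    rw [real_inner_comm]
    exact congrArg (· ⟨u, hu⟩) hzero
  refine ⟨Σ c, w c, HilbertBasis.mkOfOrthogonalEqBot hv horth,
    fun i => i.1, fun i => ?_⟩
  rw [HilbertBasis.coe_mkOfOrthogonalEqBot]
  exact mem_eigenspace_iff.1 (e i.1 i.2).2

variable {ι : Type*} {T : Module.End ℝ H} {b : HilbertBasis ι ℝ H} {τ : ι → ℝ}

theorem inner_eq_zero_of_mem_eigenspace (hT : T.IsSymmetric) (hb : ∀ i, T (b i) = τ i • b i)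
    {c : ℝ} {v : H} (hv : v ∈ eigenspace T c) {i : ι} (hi : τ i ≠ c) : inner ℝ (b i) v = 0 := by
  have h : τ i * inner ℝ (b i) v = c * inner ℝ (b i) v := by
    rw [← real_inner_smul_left, ← hb, hT, mem_eigenspace_iff.1 hv, real_inner_smul_right]
  exact (mul_eq_mul_right_iff.1 h).resolve_left hi

theorem superlevelEigenspace_eq_span (hT : T.IsSymmetric) (hb : ∀ i, T (b i) = τ i • b i) {c : ℝ}
    (hfin : {i | c ≤ τ i}.Finite) :
    superlevelEigenspace T c = Submodule.span ℝ (b '' {i | c ≤ τ i}) := by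
  refine le_antisymm (iSup₂_le fun c' hc' v hv => ?_) (Submodule.span_le.2 ?_)
  · have hsum : v = ∑ i ∈ hfin.toFinset, b.repr v i • b i := by
      refine (b.hasSum_repr v).unique (hasSum_sum_of_ne_finset_zero fun i hi => ?_)
      rw [Finite.mem_toFinset] at hi
      rw [b.repr_apply_apply, inner_eq_zero_of_mem_eigenspace hT hb hv
        fun h => hi (hc'.trans_eq h.symm), zero_smul]
    rw [hsum]
    exact Submodule.sum_mem _ fun i hi => Submodule.smul_mem _ _
      (Submodule.subset_span (mem_image_of_mem b ((Finite.mem_toFinset _).1 hi)))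
  · rintro _ ⟨i, hi, rfl⟩
    exact Submodule.mem_iSup_of_mem (τ i) (Submodule.mem_iSup_of_mem hi
      (mem_eigenspace_iff.2 (hb i)))

theorem eigenvalueSeq_eq_decreasingRearrangement (hT : T.IsSymmetric)
    (hb : ∀ i, T (b i) = τ i • b i) (hfin : ∀ c > 0, {i | c ≤ τ i}.Finite) :
    eigenvalueSeq T = decreasingRearrangement τ := by
  funext n
  rw [eigenvalueSeq_eq_sSup]
  refine congrArg sSup (Set.ext fun c => and_congr_right fun hc => ?_)
  have hli : LinearIndepOn ℝ id (b '' {i | c ≤ τ i}) :=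
    (b.orthonormal.linearIndependent.linearIndepOn _).id_image
  have hcard : Cardinal.mk (b '' {i | c ≤ τ i}) = ({i | c ≤ τ i}.ncard : ℕ) := by
    rw [← ncard_image_of_injective _ b.orthonormal.linearIndependent.injective,
      cast_ncard ((hfin c hc).image b)]
  rw [superlevelEigenspace_eq_span hT hb (hfin c hc), rank_span_set hli, hcard, Nat.cast_le,
    Nat.succ_le_iff]

end EigenvalueSeq

theorem integral_mem_of_isClosed {X E : Type*} [MeasurableSpace X] {μ : Measure X}
    [NormedAddCommGroup E] [NormedSpace ℝ E] [CompleteSpace E] {S : Submodule ℝ E}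
    (hS : IsClosed (S : Set E)) {f : X → E} (hf : ∀ x, f x ∈ S) : ∫ x, f x ∂μ ∈ S := by
  have : IsClosed (S : Set E) := hS
  by_cases hint : Integrable f μ
  · have hcomm : S.mkQL (∫ x, f x ∂μ) = ∫ x, S.mkQL (f x) ∂μ :=
      (ContinuousLinearMap.integral_comp_comm (Fₗ := E ⧸ S) S.mkQL hint).symm
    rw [← Submodule.Quotient.mk_eq_zero S]
    refine hcomm.trans (integral_eq_zero_of_ae (ae_of_all _ fun x => ?_))
    exact (Submodule.Quotient.mk_eq_zero S).2 (hf x)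
  · rw [integral_undef hint]
    exact S.zero_mem

section FeatureMap

open Filter InnerProductSpace TopologicalSpace Topology

variable {X H : Type*} [NormedAddCommGroup H] [InnerProductSpace ℝ H]

theorem countable_of_orthonormal [SeparableSpace H] {ι : Type*} {e : ι → H}
    (he : Orthonormal ℝ e) : Countable ι := by
  have hdist : ∀ i j, i ≠ j → 1 ≤ dist (e i) (e j) := fun i j hij => by
    have hsq : dist (e i) (e j) ^ 2 = 2 := by
      rw [dist_eq_norm, norm_sub_sq_real, he.2 hij, he.1 i, he.1 j]
      norm_num
    exact (one_le_sq_iff₀ dist_nonneg).1 (by rw [hsq]; norm_num)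
  have hdisj : (Set.univ : Set ι).PairwiseDisjoint fun i => Metric.ball (e i) (1 / 2) :=
    fun i _ j _ hij => Metric.ball_disjoint_ball (by linarith [hdist i j hij])
  exact Set.countable_univ_iff.1 (hdisj.countable_of_isOpen (fun _ _ => Metric.isOpen_ball)
    fun i _ => ⟨e i, Metric.mem_ball_self (by norm_num)⟩)

section Measurability

variable [MeasurableSpace X] {φ : X → H}

/-- The vectors `h` for which `x ↦ ⟪φ x, h⟫` is measurable. -/
def measurableFunctionals (φ : X → H) : Submodule ℝ H where
  carrier := {h | Measurable fun x => inner ℝ (φ x) h}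
  zero_mem' := by simp
  add_mem' hf hg := by
    simpa only [Set.mem_ofPred_eq, inner_add_right] using Measurable.fun_add hf hg
  smul_mem' c _ hf := by
    simpa only [Set.mem_ofPred_eq, real_inner_smul_right] using Measurable.const_mul hf c

theorem isClosed_measurableFunctionals (φ : X → H) :
    IsClosed (measurableFunctionals φ : Set H) :=
  isSeqClosed_iff_isClosed.1 fun _ h hu hlim =>
    measurable_of_tendsto_metrizable hu
      (tendsto_pi_nhds.2 fun x => ((innerSL ℝ (φ x)).continuous.tendsto h).comp hlim)

theorem measurable_inner_of_measurable_inner_range [CompleteSpace H]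
    (hφ : ∀ y, Measurable fun x => inner ℝ (φ x) (φ y)) (h : H) :
    Measurable fun x => inner ℝ (φ x) h := by
  -- a vector orthogonal to all `φ y` is trivially measurable, so nothing else is missing
  have hperp : (measurableFunctionals φ)ᗮ = ⊥ := by
    refine (Submodule.eq_bot_iff _).2 fun v hv => ?_
    have hzero : ∀ x, inner ℝ (φ x) v = 0 := fun x => hv _ (hφ x)
    have hvmem : v ∈ measurableFunctionals φ := by
      change Measurable fun x => inner ℝ (φ x) v
      simpa only [hzero] using measurable_const
    exact inner_self_eq_zero.1 (hv v hvmem)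
  have htop : measurableFunctionals φ = ⊤ := by
    rw [← (isClosed_measurableFunctionals φ).submodule_topologicalClosure_eq]
    exact Submodule.topologicalClosure_eq_top_iff.2 hperp
  exact htop.ge Submodule.mem_top

theorem stronglyMeasurable_of_measurable_inner [CompleteSpace H] [SeparableSpace H]
    (hφ : ∀ h, Measurable fun x => inner ℝ (φ x) h) : StronglyMeasurable φ := by
  obtain ⟨w, b, -⟩ := exists_hilbertBasis ℝ H
  have := countable_of_orthonormal b.orthonormal
  refine stronglyMeasurable_of_tendsto atTop
    (f := fun (J : Finset w) x => ∑ i ∈ J, inner ℝ (φ x) (b i) • b i) (fun J => ?_)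
    (tendsto_pi_nhds.2 fun x => ?_)
  · exact Finset.stronglyMeasurable_fun_sum _ fun i _ =>
      (hφ (b i)).stronglyMeasurable.smul_const (b i)
  · have h : HasSum (fun i => inner ℝ (φ x) (b i) • b i) (φ x) := by
      simpa only [b.repr_apply_apply, real_inner_comm] using b.hasSum_repr (φ x)
    simpa only [HasSum, SummationFilter.unconditional_filter] using h

end Measurability

theorem IsIntegrableKernel.memLp_featureMap [MeasurableSpace X] {μ : Measure X} {k : X → X → ℝ}
    [CompleteSpace H] [SeparableSpace H] (hk : IsIntegrableKernel k μ) {φ : X → H}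
    (hφ : ∀ x y, inner ℝ (φ x) (φ y) = k x y) : MemLp φ 2 μ := by
  have hinner : ∀ y, Measurable fun x => inner ℝ (φ x) (φ y) := fun y => by
    simp only [hφ]
    exact hk.measurable.comp (measurable_id.prodMk measurable_const)
  have hmeas : StronglyMeasurable φ :=
    stronglyMeasurable_of_measurable_inner (measurable_inner_of_measurable_inner_range hinner)
  refine (memLp_two_iff_integrable_sq_norm hmeas.aestronglyMeasurable).2 ?_
  simpa only [← real_inner_self_eq_norm_sq, hφ] using hk.integrable_diag

variable [MeasurableSpace X] {μ : Measure X} {φ : X → H}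

/-- The second-moment (uncentred covariance) operator `h ↦ ∫ ⟪φ x, h⟫ φ x dμ(x)` of a feature
map `φ`. -/
noncomputable def secondMomentOperator (φ : X → H) (μ : Measure X) : H →L[ℝ] H :=
  ∫ x, rankOne ℝ (φ x) (φ x) ∂μ

theorem integrable_rankOne (hφ : MemLp φ 2 μ) :
    Integrable (fun x => rankOne ℝ (φ x) (φ x)) μ := by
  refine (hφ.integrable_norm_pow two_ne_zero).mono' ?_ (ae_of_all _ fun x => ?_)
  · exact (ContinuousLinearMap.smulRightL ℝ H H).aestronglyMeasurable_comp₂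
      ((innerSL ℝ).continuous.comp_aestronglyMeasurable hφ.1) hφ.1
  · rw [norm_rankOne, sq]

theorem secondMomentOperator_apply (hφ : MemLp φ 2 μ) (h : H) :
    secondMomentOperator φ μ h = ∫ x, inner ℝ (φ x) h • φ x ∂μ :=
  ContinuousLinearMap.integral_apply (integrable_rankOne hφ) h

theorem integrable_smul_featureMap (hφ : MemLp φ 2 μ) {f : X → ℝ} (hf : MemLp f 2 μ) :
    Integrable (fun x => f x • φ x) μ :=
  memLp_one_iff_integrable.1 (hφ.smul hf)

/-- The analysis operator `h ↦ ⟪φ ·, h⟫` of a feature map `φ`. -/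
noncomputable def analysisOperator (hφ : MemLp φ 2 μ) : H →ₗ[ℝ] Lp ℝ 2 μ where
  toFun h := (hφ.inner_const h).toLp _
  map_add' g h := by
    rw [← MemLp.toLp_add]
    exact MemLp.toLp_congr _ _ (ae_of_all _ fun x => inner_add_right _ _ _)
  map_smul' c h := by
    rw [RingHom.id_apply, ← MemLp.toLp_const_smul]
    exact MemLp.toLp_congr _ _ (ae_of_all _ fun x => real_inner_smul_right _ _ _)

/-- The synthesis operator `f ↦ ∫ f(x) φ x dμ(x)` of a feature map `φ`, the adjoint of
`analysisOperator`. -/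
noncomputable def synthesisOperator (hφ : MemLp φ 2 μ) : Lp ℝ 2 μ →ₗ[ℝ] H where
  toFun f := ∫ x, f x • φ x ∂μ
  map_add' f g := by
    rw [← integral_add (integrable_smul_featureMap hφ (Lp.memLp f))
      (integrable_smul_featureMap hφ (Lp.memLp g))]
    refine integral_congr_ae ?_
    filter_upwards [Lp.coeFn_add f g] with x hx
    rw [hx, Pi.add_apply, add_smul]
  map_smul' c f := by
    rw [RingHom.id_apply, ← integral_smul]
    refine integral_congr_ae ?_
    filter_upwards [Lp.coeFn_smul c f] with x hx
    rw [hx, Pi.smul_apply, smul_assoc]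

theorem synthesisOperator_comp_analysisOperator (hφ : MemLp φ 2 μ) :
    synthesisOperator hφ ∘ₗ analysisOperator hφ = secondMomentOperator φ μ := by
  ext1 h
  rw [ContinuousLinearMap.coe_coe, secondMomentOperator_apply hφ]
  have hmem : MemLp (fun x => inner ℝ (φ x) h) 2 μ := hφ.inner_const h
  refine integral_congr_ae ?_
  filter_upwards [hmem.coeFn_toLp] with x hx
  exact congrArg (· • φ x) hx

section Complete

variable [CompleteSpace H]

theorem inner_secondMomentOperator (hφ : MemLp φ 2 μ) (g h : H) :
    inner ℝ g (secondMomentOperator φ μ h) = ∫ x, inner ℝ (φ x) g * inner ℝ (φ x) h ∂μ := by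
  rw [secondMomentOperator_apply hφ,
    ← integral_inner (integrable_smul_featureMap hφ (hφ.inner_const h))]
  simp only [real_inner_smul_right, real_inner_comm g, mul_comm]

theorem isSymmetric_secondMomentOperator (hφ : MemLp φ 2 μ) :
    (secondMomentOperator φ μ).IsSymmetric := fun g h => by
  rw [ContinuousLinearMap.coe_coe, real_inner_comm, inner_secondMomentOperator hφ,
    inner_secondMomentOperator hφ]
  simp only [mul_comm]

theorem isCompactOperator_secondMomentOperator : IsCompactOperator (secondMomentOperator φ μ) :=
  integral_mem_of_isClosed (S := compactOperator (RingHom.id ℝ) H H)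
    isClosed_setOfPred_isCompactOperator fun x =>
      ((isCompactOperator_id (E := ℝ)).comp_clm (innerSL ℝ (φ x))).clm_comp
        (ContinuousLinearMap.toSpanSingleton ℝ (φ x))

theorem analysisOperator_comp_synthesisOperator [SFinite μ] {k : X → X → ℝ}
    (hk : IsIntegrableKernel k μ) (hφ : MemLp φ 2 μ) (hφk : ∀ x y, inner ℝ (φ x) (φ y) = k x y) :
    analysisOperator hφ ∘ₗ synthesisOperator hφ = hk.integralOperator := by
  refine LinearMap.ext fun f => MemLp.toLp_congr
    (hφ.inner_const (synthesisOperator hφ f)) (hk.memLp_integral f) (ae_of_all _ fun x => ?_)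
  change inner ℝ (φ x) (∫ y, f y • φ y ∂μ) = ∫ y, k x y * f y ∂μ
  rw [← integral_inner (integrable_smul_featureMap hφ (Lp.memLp f))]
  simp only [real_inner_smul_right, hφk, mul_comm]

theorem eigenvalueSeq_integralOperator [SFinite μ] {k : X → X → ℝ}
    (hk : IsIntegrableKernel k μ) (hφ : MemLp φ 2 μ) (hφk : ∀ x y, inner ℝ (φ x) (φ y) = k x y) :
    eigenvalueSeq hk.integralOperator = eigenvalueSeq (secondMomentOperator φ μ).toLinearMap := by
  rw [← analysisOperator_comp_synthesisOperator hk hφ hφk, eigenvalueSeq_comp_comm,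
    synthesisOperator_comp_analysisOperator]

end Complete

theorem hasSum_integral_inner_sq [SeparableSpace H] {ι : Type*} (b : HilbertBasis ι ℝ H)
    (hφ : MemLp φ 2 μ) :
    HasSum (fun i => ∫ x, inner ℝ (φ x) (b i) ^ 2 ∂μ) (∫ x, ‖φ x‖ ^ 2 ∂μ) := by
  have := countable_of_orthonormal b.orthonormal
  have hparseval : ∀ x, HasSum (fun i => inner ℝ (φ x) (b i) ^ 2) (‖φ x‖ ^ 2) := fun x => by
    simpa only [real_inner_comm, ← sq, real_inner_self_eq_norm_sq]
      using b.hasSum_inner_mul_inner (φ x) (φ x)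
  refine hasSum_integral_of_dominated_convergence (fun i x => inner ℝ (φ x) (b i) ^ 2)
    (fun i => (hφ.inner_const (b i)).1.pow 2) (fun i => ae_of_all _ fun x => ?_)
    (ae_of_all _ fun x => (hparseval x).summable) ?_ (ae_of_all _ hparseval)
  · rw [Real.norm_of_nonneg (sq_nonneg _)]
  · simp only [(hparseval _).tsum_eq]
    exact hφ.integrable_norm_pow two_ne_zero

theorem norm_sub_starProjection_span_range_sq {ι : Type*} [Fintype ι] {e : ι → H}
    (he : Orthonormal ℝ e) (x : H) [(Submodule.span ℝ (Set.range e)).HasOrthogonalProjection] :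
    ‖x - (Submodule.span ℝ (Set.range e)).starProjection x‖ ^ 2 =
      ‖x‖ ^ 2 - ∑ i, inner ℝ x (e i) ^ 2 := by
  have horth : Submodule.span ℝ (Set.range e) ≤ (ℝ ∙ (x - ∑ i, inner ℝ x (e i) • e i))ᗮ := by
    rw [Submodule.span_le]
    rintro _ ⟨i, rfl⟩
    rw [SetLike.mem_coe, Submodule.mem_orthogonal_singleton_iff_inner_right, inner_sub_left,
      he.inner_left_fintype, conj_trivial, sub_self]
  have hproj : (Submodule.span ℝ (Set.range e)).starProjection x = ∑ i, inner ℝ x (e i) • e i :=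
    Submodule.eq_starProjection_of_mem_of_inner_eq_zero
      (Submodule.sum_mem _ fun i _ => Submodule.smul_mem _ _ (Submodule.subset_span ⟨i, rfl⟩))
      fun w hw => Submodule.mem_orthogonal_singleton_iff_inner_right.1 (horth hw)
  rw [hproj, norm_sub_sq_real, inner_sum, ← real_inner_self_eq_norm_sq (∑ i, _), he.inner_sum]
  simp only [real_inner_smul_right, conj_trivial, ← sq]
  ring

theorem exists_hasSum_eigenvalueSeq_secondMomentOperator [CompleteSpace H] [SeparableSpace H]
    (hφ : MemLp φ 2 μ) (s : ℕ) :
    ∃ (V : Submodule ℝ H) (_ : FiniteDimensional ℝ V), Module.finrank ℝ V ≤ s ∧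
      HasSum (fun n => eigenvalueSeq (secondMomentOperator φ μ).toLinearMap (s + n))
        (∫ x, ‖φ x - V.starProjection (φ x)‖ ^ 2 ∂μ) := by
  obtain ⟨ι, b, τ, hb⟩ := exists_hilbertBasis_eigenvectors
    (isCompactOperator_secondMomentOperator (φ := φ) (μ := μ)) (isSymmetric_secondMomentOperator hφ)
  have hτ : ∀ i, τ i = ∫ x, inner ℝ (φ x) (b i) ^ 2 ∂μ := fun i => by
    have h := inner_secondMomentOperator hφ (b i) (b i)
    simp only [hb, real_inner_smul_right, real_inner_self_eq_norm_sq, b.orthonormal.1 i] at h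
    simpa only [one_pow, mul_one, ← sq] using h
  have hsum : HasSum τ (∫ x, ‖φ x‖ ^ 2 ∂μ) := by
    simpa only [← hτ] using hasSum_integral_inner_sq b hφ
  have hfin : ∀ c > 0, {i | c ≤ τ i}.Finite := fun c hc => by
    simpa [eventually_cofinite] using hsum.summable.tendsto_cofinite_zero.eventually_lt_const hc
  have hseq : eigenvalueSeq (secondMomentOperator φ μ).toLinearMap = decreasingRearrangement τ :=
    eigenvalueSeq_eq_decreasingRearrangement (isSymmetric_secondMomentOperator hφ) hb hfin
  obtain ⟨J, hJ, htail⟩ := exists_hasSum_decreasingRearrangement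
    (fun i => (hτ i).ge.trans' (integral_nonneg fun x => sq_nonneg _)) hsum.summable s
  have hV : FiniteDimensional ℝ (Submodule.span ℝ (Set.range fun i : J => b i)) :=
    FiniteDimensional.span_of_finite ℝ (Set.finite_range _)
  refine ⟨_, hV, (finrank_range_le_card _).trans (by simpa using hJ), ?_⟩
  have herr : ∫ x, ‖φ x - (Submodule.span ℝ (Set.range fun i : J => b i)).starProjection (φ x)‖ ^ 2
      ∂μ = ∑' i, τ i - ∑ i ∈ J, τ i := by
    have he : Orthonormal ℝ fun i : J => b i := b.orthonormal.comp _ Subtype.val_injective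
    have hint : ∀ i : J, Integrable (fun x => inner ℝ (φ x) (b i) ^ 2) μ := fun i =>
      (hφ.inner_const (b i)).integrable_sq
    simp only [norm_sub_starProjection_span_range_sq he]
    rw [integral_sub (hφ.integrable_norm_pow two_ne_zero)
      (integrable_finsetSum _ fun i _ => hint i), integral_finsetSum _ fun i _ => hint i,
      hsum.tsum_eq, ← Finset.sum_coe_sort J]
    simp only [hτ]
  rw [hseq, herr]
  exact htail

end FeatureMap

section Matrix

open Matrix

theorem sum_tail_le_sum_mul_one_sub {n s : ℕ} {c p : Fin n → ℝ} (hanti : Antitone c)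
    (hc : ∀ i, 0 ≤ c i) (hp0 : ∀ i, 0 ≤ p i) (hp1 : ∀ i, p i ≤ 1) (hs : ∑ i, p i ≤ s) :
    ∑ i with s ≤ i.val, c i ≤ ∑ i, c i * (1 - p i) := by
  rcases le_or_gt n s with hns | hsn
  · rw [Finset.sum_eq_zero fun i hi => absurd (Finset.mem_filter.1 hi).2 (by omega)]
    exact Finset.sum_nonneg fun i _ => mul_nonneg (hc i) (sub_nonneg.2 (hp1 i))
  · set q : Fin n → ℝ := fun i => if s ≤ i.val then 0 else 1 with hq
    have hcount : ∑ i, q i = s := by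
      have hhead : (Finset.univ.filter fun i : Fin n => ¬ s ≤ i.val) = Finset.Iio ⟨s, hsn⟩ := by
        ext i
        simp [Fin.lt_def]
      rw [hq, Finset.sum_ite, Finset.sum_const_zero, zero_add, hhead]
      simp
    -- both factors of `(c i - c s) * (q i - p i)` change sign at the index `s`
    have hexchange : ∀ i, c ⟨s, hsn⟩ * (q i - p i) ≤ c i * (q i - p i) := fun i => by
      by_cases hi : s ≤ i.val
      · have hle : c i ≤ c ⟨s, hsn⟩ := hanti (Fin.mk_le_of_le_val hi)
        simp only [hq, if_pos hi]
        nlinarith [hp0 i]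
      · have hle : c ⟨s, hsn⟩ ≤ c i := hanti (Fin.le_def.2 (not_le.1 hi).le)
        simp only [hq, if_neg hi]
        exact mul_le_mul_of_nonneg_right hle (sub_nonneg.2 (hp1 i))
    have htail : ∑ i with s ≤ i.val, c i = ∑ i, c i * (1 - q i) := by
      rw [Finset.sum_filter]
      exact Finset.sum_congr rfl fun i _ => by by_cases hi : s ≤ i.val <;> simp [hq, hi]
    have hnonneg : 0 ≤ ∑ i, c i * (q i - p i) :=
      calc 0 ≤ c ⟨s, hsn⟩ * (s - ∑ i, p i) := mul_nonneg (hc _) (sub_nonneg.2 hs)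
        _ = ∑ i, c ⟨s, hsn⟩ * (q i - p i) := by
          rw [← Finset.mul_sum, Finset.sum_sub_distrib, hcount]
        _ ≤ _ := Finset.sum_le_sum fun i _ => hexchange i
    rw [htail, ← sub_nonneg, ← Finset.sum_sub_distrib]
    exact hnonneg.trans_eq (Finset.sum_congr rfl fun i _ => by ring)

section Spectral

variable {n : Type*} [Fintype n] [DecidableEq n] {A : Matrix n n ℝ}

theorem exists_orthonormalBasis_eigenvalues₀ (hA : A.IsHermitian) :
    ∃ b : OrthonormalBasis (Fin (Fintype.card n)) ℝ (EuclideanSpace ℝ n),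
      ∀ m, A *ᵥ b m = hA.eigenvalues₀ m • ⇑(b m) := by
  refine ⟨hA.eigenvectorBasis.reindex (Fintype.equivOfCardEq (Fintype.card_fin _)).symm,
    fun m => ?_⟩
  rw [OrthonormalBasis.reindex_apply, hA.mulVec_eigenvectorBasis, IsHermitian.eigenvalues]
  simp

theorem trace_eq_sum_eigenvalues₀ (hA : A.IsHermitian) : A.trace = ∑ m, hA.eigenvalues₀ m := by
  rw [hA.trace_eq_sum_eigenvalues]
  exact Equiv.sum_comp (Fintype.equivOfCardEq (Fintype.card_fin _)).symm hA.eigenvalues₀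

theorem eigenvalues₀_nonneg (hA : A.PosSemidef) (m : Fin (Fintype.card n)) :
    0 ≤ hA.isHermitian.eigenvalues₀ m := by
  simpa [IsHermitian.eigenvalues] using
    hA.eigenvalues_nonneg (Fintype.equivOfCardEq (Fintype.card_fin _) m)

end Spectral

theorem dotProduct_mulVec_eq_sum_mul_inner_sq {n ι : Type*} [Fintype n] [Fintype ι]
    {A : Matrix n n ℝ} {c : ι → ℝ} (hA : A.IsHermitian)
    {b : OrthonormalBasis ι ℝ (EuclideanSpace ℝ n)} (hb : ∀ m, A *ᵥ b m = c m • ⇑(b m))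
    (u : EuclideanSpace ℝ n) :
    u ⬝ᵥ A *ᵥ u = ∑ m, c m * inner ℝ (b m) u ^ 2 := by
  classical
  have hcoord : ∀ m, inner ℝ (b m) (toEuclideanLin A u) = c m * inner ℝ (b m) u := fun m => by
    have hbm : toEuclideanLin A (b m) = c m • b m := by
      ext j
      simpa using congrFun (hb m) j
    rw [← isSymmetric_toEuclideanLin_iff.mpr hA, hbm, real_inner_smul_left]
  calc u ⬝ᵥ A *ᵥ u = inner ℝ u (toEuclideanLin A u) := by
        rw [EuclideanSpace.inner_eq_star_dotProduct, dotProduct_comm]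
        simp
    _ = ∑ m, inner ℝ u (b m) * inner ℝ (b m) (toEuclideanLin A u) :=
        (b.sum_inner_mul_inner _ _).symm
    _ = ∑ m, c m * inner ℝ (b m) u ^ 2 := Finset.sum_congr rfl fun m _ => by
        rw [hcoord, real_inner_comm]
        ring

theorem sum_inner_sq_le {E ι : Type*} [NormedAddCommGroup E] [InnerProductSpace ℝ E] [Fintype ι]
    {u : ι → E} (hu : Orthonormal ℝ u) (x : E) : ∑ i, inner ℝ x (u i) ^ 2 ≤ ‖x‖ ^ 2 := by
  simpa only [Real.norm_eq_abs, sq_abs, real_inner_comm] using hu.sum_inner_products_le x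

theorem sum_dotProduct_mulVec_le_trace {n ι : Type*} [Fintype n] [Fintype ι] {A : Matrix n n ℝ}
    (hA : A.PosSemidef) {u : ι → EuclideanSpace ℝ n} (hu : Orthonormal ℝ u) :
    ∑ i, u i ⬝ᵥ A *ᵥ u i ≤ A.trace := by
  classical
  obtain ⟨b, hb⟩ := exists_orthonormalBasis_eigenvalues₀ hA.isHermitian
  simp only [dotProduct_mulVec_eq_sum_mul_inner_sq hA.isHermitian hb,
    trace_eq_sum_eigenvalues₀ hA.isHermitian]
  rw [Finset.sum_comm]
  simp only [← Finset.mul_sum]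
  refine Finset.sum_le_sum fun m _ => mul_le_of_le_one_right (eigenvalues₀_nonneg hA m) ?_
  simpa [b.orthonormal.1 m] using sum_inner_sq_le hu (b m)

section EigenvalueTail

variable {ℓ s : ℕ} {A : Matrix (Fin ℓ) (Fin ℓ) ℝ}

theorem eigenvalueTail_nonneg (hA : A.PosSemidef) (s : ℕ) : 0 ≤ eigenvalueTail hA.isHermitian s :=
  Finset.sum_nonneg fun m _ => eigenvalues₀_nonneg hA m

theorem eigenvalueTail_le_trace (hA : A.PosSemidef) (s : ℕ) :
    eigenvalueTail hA.isHermitian s ≤ A.trace := by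
  rw [trace_eq_sum_eigenvalues₀ hA.isHermitian]
  exact Finset.sum_le_sum_of_subset_of_nonneg (Finset.filter_subset _ _) fun m _ _ =>
    eigenvalues₀_nonneg hA m

theorem eigenvalueTail_le_sum_dotProduct_mulVec {ι : Type*} [Fintype ι] (hA : A.PosSemidef)
    {u : ι → EuclideanSpace ℝ (Fin ℓ)} (hu : Orthonormal ℝ u) (hcard : ℓ ≤ Fintype.card ι + s) :
    eigenvalueTail hA.isHermitian s ≤ ∑ i, u i ⬝ᵥ A *ᵥ u i := by
  obtain ⟨b, hb⟩ := exists_orthonormalBasis_eigenvalues₀ hA.isHermitian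
  set q : Fin (Fintype.card (Fin ℓ)) → ℝ := fun m => ∑ i, inner ℝ (b m) (u i) ^ 2 with hq
  have hq0 : ∀ m, 0 ≤ q m := fun m => Finset.sum_nonneg fun _ _ => sq_nonneg _
  have hq1 : ∀ m, q m ≤ 1 := fun m => by
    simpa [b.orthonormal.1 m] using sum_inner_sq_le hu (b m)
  have hqsum : ∑ m, q m = Fintype.card ι := by
    rw [hq, Finset.sum_comm]
    have hone : ∀ i, ∑ m, inner ℝ (b m) (u i) ^ 2 = 1 := fun i => by
      simpa [hu.1 i] using b.sum_sq_norm_inner_right (u i)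
    simp [hone]
  have hsum : ∑ m, (1 - q m) ≤ s := by
    rw [Finset.sum_sub_distrib, hqsum]
    simpa [add_comm] using (Nat.cast_le (α := ℝ)).2 hcard
  calc eigenvalueTail hA.isHermitian s
      ≤ ∑ m, hA.isHermitian.eigenvalues₀ m * (1 - (1 - q m)) :=
        sum_tail_le_sum_mul_one_sub hA.isHermitian.eigenvalues₀_antitone (eigenvalues₀_nonneg hA)
          (fun m => sub_nonneg.2 (hq1 m)) (fun m => sub_le_self _ (hq0 m)) hsum
    _ = ∑ i, u i ⬝ᵥ A *ᵥ u i := by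
        simp only [dotProduct_mulVec_eq_sum_mul_inner_sq hA.isHermitian hb, sub_sub_cancel, hq,
          Finset.mul_sum]
        exact Finset.sum_comm

theorem exists_orthonormal_sum_smul_eq_zero {H : Type*} [AddCommGroup H] [Module ℝ H]
    {V : Submodule ℝ H} [FiniteDimensional ℝ V] (hV : Module.finrank ℝ V ≤ s) {ψ : Fin ℓ → H}
    (hψ : ∀ j, ψ j ∈ V) :
    ∃ (m : ℕ) (u : Fin m → EuclideanSpace ℝ (Fin ℓ)), Orthonormal ℝ u ∧ ℓ ≤ m + s ∧
      ∀ i, ∑ j, u i j • ψ j = 0 := by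
  let T : EuclideanSpace ℝ (Fin ℓ) →ₗ[ℝ] V :=
    Fintype.linearCombination ℝ (fun j => (⟨ψ j, hψ j⟩ : V)) ∘ₗ
      (WithLp.linearEquiv 2 ℝ (Fin ℓ → ℝ)).toLinearMap
  have hT : ∀ x, (T x : H) = ∑ j, x j • ψ j := fun x => by
    simp [T, Fintype.linearCombination_apply]
  let u := stdOrthonormalBasis ℝ (LinearMap.ker T)
  refine ⟨_, fun i => u i, u.orthonormal.comp_linearIsometry (LinearMap.ker T).subtypeₗᵢ, ?_,
    fun i => ?_⟩
  · have hrank := T.finrank_range_add_finrank_ker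
    have hrange := Submodule.finrank_le (LinearMap.range T)
    rw [finrank_euclideanSpace_fin] at hrank
    omega
  · have hker : T (u i) = 0 := (u i).2
    rw [← hT, hker, ZeroMemClass.coe_zero]

theorem eigenvalueTail_le_sum_norm_sub_sq {H : Type*} [NormedAddCommGroup H]
    [InnerProductSpace ℝ H] {φ ψ : Fin ℓ → H} (hA : A.IsHermitian) (hφ : gram ℝ φ = A)
    {V : Submodule ℝ H} [FiniteDimensional ℝ V] (hV : Module.finrank ℝ V ≤ s)
    (hψ : ∀ j, ψ j ∈ V) : eigenvalueTail hA s ≤ ∑ j, ‖φ j - ψ j‖ ^ 2 := by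
  subst hφ
  obtain ⟨m, u, hu, hm, hzero⟩ := exists_orthonormal_sum_smul_eq_zero hV hψ
  have hquad : ∀ (v : Fin ℓ → H) i, u i ⬝ᵥ gram ℝ v *ᵥ u i = ‖∑ j, u i j • v j‖ ^ 2 :=
    fun v i => by
      rw [← real_inner_self_eq_norm_sq, ← star_dotProduct_gram_mulVec, star_trivial]
  calc eigenvalueTail hA s
      ≤ ∑ i, u i ⬝ᵥ gram ℝ φ *ᵥ u i :=
        eigenvalueTail_le_sum_dotProduct_mulVec (posSemidef_gram ℝ φ) hu (by simpa using hm)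
    _ = ∑ i, u i ⬝ᵥ gram ℝ (φ - ψ) *ᵥ u i := by
        simp only [hquad, Pi.sub_apply, smul_sub, Finset.sum_sub_distrib, hzero, sub_zero]
    _ ≤ (gram ℝ (φ - ψ)).trace := sum_dotProduct_mulVec_le_trace (posSemidef_gram ℝ _) hu
    _ = ∑ j, ‖φ j - ψ j‖ ^ 2 := by simp [trace, gram_apply]

theorem upperSemicontinuous_eigenvalueTail (ℓ s : ℕ) :
    UpperSemicontinuous fun a : {a : Fin ℓ → Fin ℓ → ℝ // (of a).PosSemidef} =>
      eigenvalueTail a.2.isHermitian s := by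
  intro a y hy
  obtain ⟨b, hb⟩ := exists_orthonormalBasis_eigenvalues₀ a.2.isHermitian
  -- by Ky Fan, the functional `g` dominates the tail everywhere, with equality at `a`
  let g : {a : Fin ℓ → Fin ℓ → ℝ // (of a).PosSemidef} → ℝ := fun a' =>
    ∑ i : {i : Fin (Fintype.card (Fin ℓ)) // s ≤ i.val}, b i ⬝ᵥ of a'.1 *ᵥ b i
  have hof : Continuous fun a' : {a : Fin ℓ → Fin ℓ → ℝ // (of a).PosSemidef} => of a'.1 :=
    continuous_subtype_val
  have hg : Continuous g := continuous_finsetSum _ fun i _ =>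
    continuous_const.dotProduct (hof.matrix_mulVec continuous_const)
  have hga : g a = eigenvalueTail a.2.isHermitian s := by
    have hunit : ∀ i, b i ⬝ᵥ b i = (1 : ℝ) := fun i => by
      have hinner := b.inner_eq_one i
      rwa [EuclideanSpace.inner_eq_star_dotProduct, star_trivial] at hinner
    simp only [g, hb, dotProduct_smul, hunit, smul_eq_mul, mul_one]
    exact (Finset.sum_subtype _ (by simp) _).symm
  have hcard : ℓ ≤ Fintype.card {i : Fin (Fintype.card (Fin ℓ)) // s ≤ i.val} + s := by
    have hlt := Fin.card_filter_val_lt (n := Fintype.card (Fin ℓ)) (m := s)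
    have hadd := Finset.card_filter_add_card_filter_not (s := Finset.univ)
      fun i : Fin (Fintype.card (Fin ℓ)) => s ≤ i.val
    simp only [not_le, hlt, Finset.card_univ, Fintype.card_fin, ← Fintype.card_subtype] at hadd
    omega
  have hle : ∀ a', eigenvalueTail a'.2.isHermitian s ≤ g a' := fun a' =>
    eigenvalueTail_le_sum_dotProduct_mulVec a'.2 (b.orthonormal.comp _ Subtype.val_injective) hcard
  filter_upwards [(hg.tendsto a).eventually_lt_const (hga.trans_lt hy)] with a' ha'
  exact (hle a').trans_lt ha'

theorem measurable_eigenvalueTail {α : Type*} [MeasurableSpace α]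
    {A : α → Matrix (Fin ℓ) (Fin ℓ) ℝ} (hA : ∀ x, (A x).PosSemidef)
    (hm : ∀ i j, Measurable fun x => A x i j) (s : ℕ) :
    Measurable fun x => eigenvalueTail (hA x).isHermitian s := by
  let S : Type := {a : Fin ℓ → Fin ℓ → ℝ // (of a).PosSemidef}
  have htail : Measurable fun a : S => eigenvalueTail a.2.isHermitian s :=
    (upperSemicontinuous_eigenvalueTail ℓ s).measurable
  have hAS : Measurable fun x => (⟨A x, hA x⟩ : S) :=
    Measurable.subtype_mk (measurable_pi_lambda _ fun i => measurable_pi_lambda _ (hm i))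
  have hcomp : (fun x => eigenvalueTail (hA x).isHermitian s) =
      (fun a : S => eigenvalueTail a.2.isHermitian s) ∘ fun x => ⟨A x, hA x⟩ :=
    funext fun x => rfl
  rw [hcomp]
  exact htail.comp hAS

end EigenvalueTail

end Matrix

section Sample

variable {X Ω : Type*} [MeasurableSpace X] [MeasurableSpace Ω] {μ : Measure X} {P : Measure Ω}
  {ℓ : ℕ} {Z : Fin ℓ → Ω → X}

theorem integrable_comp_of_hasLaw {Y : Ω → X} {f : X → ℝ} (hf : Integrable f μ)
    (hY : HasLaw Y μ P) : Integrable (fun ω => f (Y ω)) P := by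
  rw [← hY.map_eq] at hf
  exact hf.comp_aemeasurable hY.aemeasurable

theorem integral_sampleMean_le {f : X → ℝ} (hf : Integrable f μ) (hf0 : ∀ x, 0 ≤ f x)
    (hlaw : ∀ i, HasLaw (Z i) μ P) :
    ∫ ω, (1 / (ℓ : ℝ)) * ∑ i, f (Z i ω) ∂P ≤ ∫ x, f x ∂μ := by
  have hlawf : ∀ i, ∫ ω, f (Z i ω) ∂P = ∫ x, f x ∂μ := fun i =>
    (hlaw i).integral_comp hf.aestronglyMeasurable
  rw [integral_const_mul, integral_finsetSum _ fun i _ => integrable_comp_of_hasLaw hf (hlaw i)]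
  simp only [hlawf, Finset.sum_const, Finset.card_univ, Fintype.card_fin, nsmul_eq_mul]
  rw [← mul_assoc, one_div]
  -- an inequality only because the left-hand side is `0` when `ℓ = 0`
  exact mul_le_of_le_one_left (integral_nonneg hf0) inv_mul_le_one

variable {k : X → X → ℝ}

theorem aemeasurable_eigenvalueTail_gramMatrix (hk : IsIntegrableKernel k μ)
    (hZ : ∀ i, AEMeasurable (Z i) P) (s : ℕ) :
    AEMeasurable (fun ω => eigenvalueTail (hk.isHermitian_gramMatrix fun i => Z i ω) s) P := by
  have hentry : ∀ i j, Measurable fun z : Fin ℓ → X => gramMatrix k z i j := fun i j =>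
    hk.measurable.comp (g := Function.uncurry k) (f := fun z : Fin ℓ → X => (z i, z j))
      ((measurable_pi_apply i).prodMk (measurable_pi_apply j))
  exact (measurable_eigenvalueTail (fun z => hk.posSemidef.submatrix z) hentry s).comp_aemeasurable
    (aemeasurable_pi_lambda (fun ω i => Z i ω) hZ)

theorem integrable_eigenvalueTail_gramMatrix (hk : IsIntegrableKernel k μ)
    (hlaw : ∀ i, HasLaw (Z i) μ P) (s : ℕ) :
    Integrable (fun ω => eigenvalueTail (hk.isHermitian_gramMatrix fun i => Z i ω) s) P := by
  have htrace : Integrable (fun ω => ∑ i, k (Z i ω) (Z i ω)) P :=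
    integrable_finsetSum _ fun i _ => integrable_comp_of_hasLaw hk.integrable_diag (hlaw i)
  refine htrace.mono' (aemeasurable_eigenvalueTail_gramMatrix hk
    (fun i => (hlaw i).aemeasurable) s).aestronglyMeasurable (ae_of_all _ fun ω => ?_)
  have hpsd : (gramMatrix k fun i => Z i ω).PosSemidef := hk.posSemidef.submatrix _
  exact (Real.norm_of_nonneg (eigenvalueTail_nonneg hpsd s)).trans_le
    (eigenvalueTail_le_trace hpsd s)

variable {H : Type*} [NormedAddCommGroup H] [InnerProductSpace ℝ H] {φ : X → H}

theorem eigenvalueTail_gramMatrix_le (hk : IsIntegrableKernel k μ)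
    (hφ : ∀ x y, inner ℝ (φ x) (φ y) = k x y) {s : ℕ} {V : Submodule ℝ H} [FiniteDimensional ℝ V]
    (hV : Module.finrank ℝ V ≤ s) (z : Fin ℓ → X) :
    eigenvalueTail (hk.isHermitian_gramMatrix z) s ≤
      ∑ i, ‖φ (z i) - V.starProjection (φ (z i))‖ ^ 2 :=
  eigenvalueTail_le_sum_norm_sub_sq _ (Matrix.ext fun i j => hφ (z i) (z j)) hV fun i =>
    V.starProjection_apply_mem (φ (z i))

theorem lemma3p3_general [SFinite μ] [CompleteSpace H] [TopologicalSpace.SeparableSpace H]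
    (hk : IsIntegrableKernel k μ) (hφ : ∀ x y, inner ℝ (φ x) (φ y) = k x y)
    (hlaw : ∀ i, HasLaw (Z i) μ P) (s : ℕ) :
    Summable (fun i => eigenvalueSeq hk.integralOperator (s + i)) ∧
    Integrable (fun ω =>
      (1 / (ℓ : ℝ)) * eigenvalueTail (hk.isHermitian_gramMatrix fun i => Z i ω) s) P ∧
    ∫ ω, (1 / (ℓ : ℝ)) * eigenvalueTail (hk.isHermitian_gramMatrix fun i => Z i ω) s ∂P
      ≤ ∑' i, eigenvalueSeq hk.integralOperator (s + i) := by
  have hmem : MemLp φ 2 μ := hk.memLp_featureMap hφ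
  obtain ⟨V, _, hV, hsum⟩ := exists_hasSum_eigenvalueSeq_secondMomentOperator hmem s
  rw [← eigenvalueSeq_integralOperator hk hmem hφ] at hsum
  let R : X → ℝ := fun x => ‖φ x - V.starProjection (φ x)‖ ^ 2
  have hR : Integrable R μ :=
    (hmem.sub (V.starProjection.comp_memLp' hmem)).integrable_norm_pow two_ne_zero
  have hmean : Integrable (fun ω => (1 / (ℓ : ℝ)) * ∑ i, R (Z i ω)) P :=
    (integrable_finsetSum _ fun i _ => integrable_comp_of_hasLaw hR (hlaw i)).const_mul _
  have hle : ∀ ω, (1 / (ℓ : ℝ)) * eigenvalueTail (hk.isHermitian_gramMatrix fun i => Z i ω) s ≤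
      (1 / (ℓ : ℝ)) * ∑ i, R (Z i ω) := fun ω =>
    mul_le_mul_of_nonneg_left (eigenvalueTail_gramMatrix_le hk hφ hV _) (by positivity)
  have hint := (integrable_eigenvalueTail_gramMatrix hk hlaw s).const_mul (1 / (ℓ : ℝ))
  refine ⟨hsum.summable, hint, (integral_mono hint hmean hle).trans ?_⟩
  rw [hsum.tsum_eq]
  exact integral_sampleMean_le hR (fun x => sq_nonneg _) hlaw

end Sample

theorem lemma3p3
    {X : Type*} [MeasurableSpace X] (μ : Measure X) [IsProbabilityMeasure μ]
    (k : X → X → ℝ) (hk : IsIntegrableKernel k μ)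
    -- `H` is the reproducing kernel Hilbert space of `k`; it is separable
    (H : Type*) [NormedAddCommGroup H] [InnerProductSpace ℝ H] [CompleteSpace H]
    [RKHS ℝ H X ℝ] (hH : ∀ x y, RKHS.kernel H x y 1 = k x y)
    [TopologicalSpace.SeparableSpace H]
    -- `Z` is an i.i.d. sample from `μ`
    {Ω : Type*} [MeasurableSpace Ω] (P : Measure Ω) [IsProbabilityMeasure P]
    (ℓ : ℕ) (Z : Fin ℓ → Ω → X) (hlaw : ∀ i, HasLaw (Z i) μ P) (hindep : iIndepFun Z P)
    (s : ℕ) :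
    Summable (fun i => eigenvalueSeq hk.integralOperator (s + i)) ∧
    Integrable (fun ω =>
      (1 / (ℓ : ℝ)) * eigenvalueTail (hk.isHermitian_gramMatrix fun i => Z i ω) s) P ∧
    ∫ ω, (1 / (ℓ : ℝ)) * eigenvalueTail (hk.isHermitian_gramMatrix fun i => Z i ω) s ∂P
      ≤ ∑' i, eigenvalueSeq hk.integralOperator (s + i) :=
  lemma3p3_general hk (φ := fun x => RKHS.kerFun H x (1 : ℝ))
    (fun x y => by rw [RKHS.kerFun_inner, RKHS.kerFun_apply, hH]; simp) hlaw s
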